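/- **Proposition 5.1.** Let $(G^{(n)}_k)_{n,k\in\mathbb N_0}$ be iid random variables with the ${\rm Geom}(1/2)$ distribution on $\mathbb N_0=\{0,1,2,\ldots\}$, that is, $\mathbb P\{G^{(n)}_k=j\}=2^{-(j+1)}$ for $j\in\mathbb N_0$. Let $Z^{\rm crit}_0=0$ and $Z^{\rm crit}_{n+1}=\sum_{k=0}^{Z^{\rm crit}_n}G^{(n)}_k$ for $n\in\mathbb N_0$ (the critical Galton–Watson process with unit immigration and ${\rm Geom}(1/2)$ offspring distribution, the immigrants themselves not being counted), and let $W^{\rm crit}_n=\sum_{k=1}^n Z^{\rm crit}_k$, $n\in\mathbb N_0$, be the total progeny in the first $n$ generations. Let $\varsigma$ be an $\mathbb N_0$-valued random variable which is independent of $(W^{\rm crit}_n)_{n\in\mathbb N_0}$ and satisfies $$\mathbb P\{\varsigma>x\}\sim x^{-2\alpha}\ell(x),\qquad x\to\infty,$$ for some $\alpha>0$ and some $\ell$ slowly varying at $\infty$ (that is, $\ell$ is positive and measurable on some half-line $[a,\infty)$ and $\ell(cx)/\ell(x)\to1$ as $x\to\infty$ for every $c>0$). Then $$\mathbb P\{W^{\rm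 crit}_\varsigma>x\}\sim\mathbb E\vartheta^\alpha\,\mathbb P\{\varsigma>x^{1/2}\}\sim\mathbb E\vartheta^\alpha\,x^{-\alpha}\ell(x^{1/2}),\qquad x\to\infty,$$ where $\vartheta$ is a random variable with Laplace transform $\mathbb E e^{-s\vartheta}=1/\cosh(\sqrt s)$, $s\ge0$; such a random variable exists, and $\mathbb E\vartheta^\alpha<\infty$. -/

import Mathlib

open MeasureTheory ProbabilityTheory Filter Topology Asymptotics

namespace CritGW

/-- `ℓ` is slowly varying at `∞`: it is positive and measurable on some half-line `[a, ∞)`, and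
`ℓ (c x) / ℓ x → 1` as `x → ∞`, for every `c > 0`. -/
structure SlowlyVarying (ℓ : ℝ → ℝ) : Prop where
  pos_measurable : ∃ a : ℝ, (∀ x, a ≤ x → 0 < ℓ x) ∧ Measurable fun x : Set.Ici a ↦ ℓ x
  tendsto_ratio : ∀ c : ℝ, 0 < c → Tendsto (fun x ↦ ℓ (c * x) / ℓ x) atTop (𝓝 1)

/-- The success probability `1/2`. -/
noncomputable def half : unitInterval := ⟨1 / 2, by norm_num, by norm_num⟩

variable {Ω : Type*}

/-- `G n k`, for `n, k ∈ ℕ₀`, are iid random variables with the distribution `Geom(1/2)` on `ℕ₀`,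
which gives mass `2^{-(j+1)}` to `j`. -/
structure IsOffspringArray [MeasurableSpace Ω] (μ : Measure Ω) (G : ℕ → ℕ → Ω → ℕ) : Prop where
  measurable : ∀ n k, Measurable (G n k)
  law : ∀ n k, HasLaw (G n k) (geometricMeasure half) μ
  indep : iIndepFun (fun p : ℕ × ℕ ↦ G p.1 p.2) μ

/-- Generation sizes of the Galton--Watson process with unit immigration built from the offspring
numbers `G`. The process is empty at time `0`. Generation `n + 1` consists of the `G n 0` children
of the immigrant entering generation `n` and, for `1 ≤ k ≤ Z n`, the `G n k` children of the `k`-th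
particle of generation `n`. Immigrants themselves are not counted. -/
def Z (G : ℕ → ℕ → Ω → ℕ) : ℕ → Ω → ℕ
  | 0, _ => 0
  | n + 1, ω => ∑ k ∈ Finset.range (Z G n ω + 1), G n k ω

/-- Total progeny in generations `1, …, n`. -/
def W (G : ℕ → ℕ → Ω → ℕ) (n : ℕ) (ω : Ω) : ℕ := ∑ k ∈ Finset.Icc 1 n, Z G k ω

/-- `ν` is the distribution of a real random variable `ϑ` with `E e^{-sϑ} = 1 / cosh (√s)`
for all `s ≥ 0`. (The right-hand side is nonzero, so the integral exists for these `s`, and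
`ϑ > 0` almost surely.) -/
structure IsVarthetaLaw (ν : Measure ℝ) : Prop where
  isProbabilityMeasure : IsProbabilityMeasure ν
  laplace : ∀ s : ℝ, 0 ≤ s → ∫ t, Real.exp (-s * t) ∂ν = 1 / Real.cosh (√s)

end CritGW

/-! Conditionally on the path of `W`, the probability of `W_ς > x` is `P(ς > τ)`, where `τ` is the
last time at which `W ≤ x`. Since `W_n` is of order `n² ϑ`, `τ` is close to `√x ϑ^(-1/2)`, and
regular variation with index `-2α` gives `P(ς > τ) ≈ ϑ^α P(ς > √x)`. Taking expectations yields the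
claim.

The limit law comes from an exact formula. The offspring generating function `1/(2 - z)` is a Möbius
map, so `E s^(W_n)` is the reciprocal of a solution of a linear recurrence (`lintegral_pow_W`). With
`s = e^(-u/x)` and `n ~ b√x` it tends to `1/cosh(b√u)`. The same formula for `s` slightly above `1`
bounds an exponential moment of `W_n/n²` and hence all its power tails (`exists_measure_lt_W_le`).

The expectation is written as an integral over levels `v` (`ofReal_tail_ratio_eq_lintegral_level`).
As `W` is monotone, each level event is compared with `W_N > x` at a deterministic `N = ⌊b√x⌋`, so
weak convergence gives the limit for almost every `v`. A Potter-type bound combined with the power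
tails dominates the integrand (`exists_level_bound`). -/

namespace CritGW

open scoped ENNReal unitInterval

/-! ### Exact generating function of the total progeny -/

section GeneratingFunction

variable {Ω : Type*} {G : ℕ → ℕ → Ω → ℕ}

/-- The `σ`-algebra generated by the offspring numbers of the generations `n` in `S`. -/
abbrev rowSigma (G : ℕ → ℕ → Ω → ℕ) (S : Set ℕ) : MeasurableSpace Ω :=
  ⨆ p ∈ {p : ℕ × ℕ | p.1 ∈ S}, MeasurableSpace.comap (G p.1 p.2) inferInstance

lemma measurable_rowSigma {S : Set ℕ} {n : ℕ} (hn : n ∈ S) (k : ℕ) :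
    Measurable[rowSigma G S] (G n k) := by
  refine Measurable.mono (comap_measurable (G n k)) ?_ le_rfl
  exact le_iSup₂_of_le (f := fun (p : ℕ × ℕ) (_ : p ∈ {p : ℕ × ℕ | p.1 ∈ S}) ↦
    MeasurableSpace.comap (G p.1 p.2) inferInstance) (n, k) hn le_rfl

lemma rowSigma_mono {S T : Set ℕ} (h : S ⊆ T) : rowSigma G S ≤ rowSigma G T :=
  biSup_mono fun _ hp ↦ h hp

lemma measurable_Z_rowSigma (n : ℕ) : Measurable[rowSigma G (Set.Iio n)] (Z G n) := by
  induction n with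
  | zero => exact @measurable_const _ _ _ (rowSigma G _) 0
  | succ n ih =>
    have h1 : Measurable[rowSigma G (Set.Iio (n + 1))] (Z G n) :=
      ih.mono (rowSigma_mono (Set.Iio_subset_Iio n.le_succ)) le_rfl
    have h2 : ∀ k, Measurable[rowSigma G (Set.Iio (n + 1))] (G n k) :=
      fun k ↦ measurable_rowSigma (Set.mem_Iio.2 n.lt_succ_self) k
    let _ : MeasurableSpace Ω := rowSigma G (Set.Iio (n + 1))
    have h3 : Measurable fun q : ℕ × Ω ↦ ∑ k ∈ Finset.range (q.1 + 1), G n k q.2 :=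
      measurable_from_prod_countable_right fun j ↦
        Finset.measurable_sum (Finset.range (j + 1)) fun k _ ↦ h2 k
    exact h3.comp (h1.prodMk measurable_id)

lemma W_succ (n : ℕ) (ω : Ω) : W G (n + 1) ω = W G n ω + Z G (n + 1) ω := by
  simp [W, Finset.sum_Icc_succ_top]

lemma measurable_W_rowSigma (n : ℕ) : Measurable[rowSigma G (Set.Iio n)] (W G n) := by
  let _ : MeasurableSpace Ω := rowSigma G (Set.Iio n)
  refine Finset.measurable_sum _ fun k hk ↦ ?_
  exact (measurable_Z_rowSigma k).mono
    (rowSigma_mono (Set.Iio_subset_Iio (Finset.mem_Icc.1 hk).2)) le_rfl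

variable [mΩ : MeasurableSpace Ω] {μ : Measure Ω}

lemma rowSigma_le (hG : IsOffspringArray μ G) (S : Set ℕ) : rowSigma G S ≤ mΩ :=
  iSup₂_le fun p _ ↦ (hG.measurable p.1 p.2).comap_le

lemma indep_rowSigma (hG : IsOffspringArray μ G) {S T : Set ℕ} (h : Disjoint S T) :
    Indep (rowSigma G S) (rowSigma G T) μ := by
  refine indep_iSup_of_disjoint
    (m := fun p : ℕ × ℕ ↦ MeasurableSpace.comap (G p.1 p.2) inferInstance)
    (fun p ↦ (hG.measurable p.1 p.2).comap_le) hG.indep.iIndep ?_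
  exact Set.disjoint_left.2 fun p hS hT ↦ Set.disjoint_left.1 h hS hT

lemma measurable_W (hG : IsOffspringArray μ G) (n : ℕ) : Measurable (W G n) :=
  (measurable_W_rowSigma n).mono (rowSigma_le hG _) le_rfl

lemma measurable_Z (hG : IsOffspringArray μ G) (n : ℕ) : Measurable (Z G n) :=
  (measurable_Z_rowSigma n).mono (rowSigma_le hG _) le_rfl

/-- The range reaches past `1` up to the pole at `2`, as exponential moments of `W` require. -/
lemma lintegral_pow_offspring (hG : IsOffspringArray μ G) (n k : ℕ) {z : ℝ} (h0 : 0 ≤ z)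
    (h2 : z < 2) : ∫⁻ ω, ENNReal.ofReal z ^ G n k ω ∂μ = ENNReal.ofReal (1 / (2 - z)) := by
  have hne : half ≠ 0 := by
    intro h; have := congrArg Subtype.val h; norm_num [half] at this
  have hm : Measurable fun j : ℕ ↦ ENNReal.ofReal z ^ j := measurable_of_countable _
  have := lintegral_map (μ := μ) hm (hG.measurable n k)
  rw [← this, (hG.law n k).map_eq, geometricMeasure_eq hne, lintegral_sum_measure]
  simp only [lintegral_smul_measure, lintegral_dirac, smul_eq_mul]
  have hs : HasSum (fun j : ℕ ↦ (1 / 2 : ℝ) * (z / 2) ^ j) ((1 / 2) * (1 - z / 2)⁻¹) :=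
    (hasSum_geometric_of_lt_one (by positivity) (by linarith)).mul_left _
  have hv : (1 / 2) * (1 - z / 2)⁻¹ = 1 / (2 - z) := by
    have : (2 - z) ≠ 0 := by linarith
    have : (1 - z / 2) ≠ 0 := by intro h; apply this; linarith
    field_simp
  rw [← hv, ← hs.tsum_eq, ENNReal.ofReal_tsum_of_nonneg (fun j ↦ by positivity) hs.summable]
  refine tsum_congr fun j ↦ ?_
  rw [← ENNReal.ofReal_pow h0, ← ENNReal.ofReal_mul (geometricMeasure_nonneg half j)]
  congr 1
  simp only [half, div_pow]
  norm_num
  field_simp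
  rw [← mul_pow, ← mul_pow]; ring

/-- One-step recursion for the joint generating function of total progeny and generation size. -/
lemma lintegral_pow_W_mul_pow_Z_succ (hG : IsOffspringArray μ G) (n : ℕ) (s : ℝ≥0∞) {y z : ℝ≥0∞}
    (hz : ∀ k, ∫⁻ ω, (s * y) ^ G n k ω ∂μ = z) :
    ∫⁻ ω, s ^ W G (n + 1) ω * y ^ Z G (n + 1) ω ∂μ =
      z * ∫⁻ ω, s ^ W G n ω * z ^ Z G n ω ∂μ := by
  have hpow (a : ℝ≥0∞) : Measurable fun j : ℕ ↦ a ^ j := measurable_of_countable _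
  have hZ := measurable_Z hG n
  have hW := measurable_W hG n
  -- On `Z n = j` the next generation is a sum of `j + 1` variables of row `n`, independent of the
  -- earlier rows, which determine `W n` and `Z n`.
  have key (j : ℕ) : ∫⁻ ω, (Z G n ⁻¹' {j}).indicator (fun ω ↦ s ^ W G n ω) ω *
      ∏ k ∈ Finset.range (j + 1), (s * y) ^ G n k ω ∂μ =
      (∫⁻ ω, (Z G n ⁻¹' {j}).indicator (fun ω ↦ s ^ W G n ω) ω ∂μ) * z ^ (j + 1) := by
    rw [lintegral_mul_eq_lintegral_mul_lintegral_of_independent_measurableSpace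
      (rowSigma_le hG (Set.Iio n)) (rowSigma_le hG {n})
      (indep_rowSigma hG (by simp)), lintegral_prod_eq_prod_lintegral_of_indepFun]
    · simp [hz]
    · have : iIndepFun (fun k ↦ G n k) μ :=
        hG.indep.precomp (g := fun k : ℕ ↦ (n, k)) (Prod.mk_right_injective n)
      exact this.comp (fun _ j ↦ (s * y) ^ j) fun _ ↦ hpow _
    · exact fun k ↦ (hpow _).comp (hG.measurable n k)
    · exact Measurable.indicator ((hpow s).comp (measurable_W_rowSigma n))
        (measurable_Z_rowSigma n (measurableSet_singleton j))
    · let _ : MeasurableSpace Ω := rowSigma G {n}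
      have h : ∀ k, Measurable fun ω ↦ (s * y) ^ G n k ω := fun k ↦
        (hpow _).comp (measurable_rowSigma (Set.mem_singleton n) k)
      exact Finset.measurable_fun_prod (Finset.range (j + 1)) fun k _ ↦ h k
  have hsum (f : ℕ → Ω → ℝ≥0∞) (ω : Ω) :
      f (Z G n ω) ω = ∑' j, (Z G n ⁻¹' {j}).indicator (f j) ω := by
    rw [tsum_eq_single (Z G n ω) fun j hj ↦ by simp [Set.indicator, hj.symm]]
    simp
  have e1 (ω : Ω) : s ^ W G (n + 1) ω * y ^ Z G (n + 1) ω =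
      ∑' j, (Z G n ⁻¹' {j}).indicator (fun ω ↦ s ^ W G n ω) ω *
        ∏ k ∈ Finset.range (j + 1), (s * y) ^ G n k ω := by
    have := hsum (fun j ω ↦ s ^ W G n ω * ∏ k ∈ Finset.range (j + 1), (s * y) ^ G n k ω) ω
    simp only [Set.indicator_mul_left] at this
    rw [← this, Finset.prod_pow_eq_pow_sum, W_succ, pow_add, mul_assoc, ← mul_pow]
    rfl
  have e2 (ω : Ω) : z * (s ^ W G n ω * z ^ Z G n ω) =
      ∑' j, (Z G n ⁻¹' {j}).indicator (fun ω ↦ s ^ W G n ω) ω * z ^ (j + 1) := by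
    have := hsum (fun j ω ↦ s ^ W G n ω * z ^ (j + 1)) ω
    simp only [Set.indicator_mul_left] at this
    rw [← this, pow_succ]; ring
  have hind (j : ℕ) : Measurable ((Z G n ⁻¹' {j}).indicator (fun ω ↦ s ^ W G n ω)) :=
    Measurable.indicator ((hpow s).comp hW) (hZ (measurableSet_singleton j))
  have hm : Measurable fun ω ↦ s ^ W G n ω * z ^ Z G n ω :=
    ((hpow s).comp hW).mul ((hpow z).comp hZ)
  rw [← lintegral_const_mul _ hm]
  simp only [e1, e2]
  rw [lintegral_tsum, lintegral_tsum]
  · refine tsum_congr fun j ↦ ?_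
    rw [key, lintegral_mul_const _ (hind j)]
  · exact fun j ↦ ((hind j).mul_const _).aemeasurable
  · exact fun j ↦ ((hind j).mul (Finset.measurable_fun_prod (Finset.range (j + 1)) fun k _ ↦
      (hpow (s * y)).comp (hG.measurable n k))).aemeasurable

/-- Writing the argument as `Q 0 / Q 1` linearises the Möbius map: one generation sends it to `Q 1 /
Q 2`, a shift of `Q`, and the prefactors telescope. -/
lemma lintegral_pow_W_mul_pow_Z [IsProbabilityMeasure μ] (hG : IsOffspringArray μ G) {s : ℝ}
    (hs : 0 ≤ s) (n : ℕ) (Q : ℕ → ℝ) (hpos : ∀ i ≤ n + 1, 0 < Q i)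
    (hrec : ∀ i < n, Q (i + 2) = 2 * Q (i + 1) - s * Q i) :
    ∫⁻ ω, ENNReal.ofReal s ^ W G n ω * ENNReal.ofReal (Q 0 / Q 1) ^ Z G n ω ∂μ =
      ENNReal.ofReal (Q 1 / Q (n + 1)) := by
  induction n generalizing Q with
  | zero => simp [W, Z, (hpos 1 le_rfl).ne']
  | succ n ih =>
    have q0 := hpos 0 (by omega)
    have q1 := hpos 1 (by omega)
    have q2 := hpos 2 (by omega)
    have hr := hrec 0 (by omega)
    have e : 1 / (2 - s * (Q 0 / Q 1)) = Q 1 / Q 2 := by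
      rw [show 2 - s * (Q 0 / Q 1) = Q 2 / Q 1 by rw [hr]; field_simp, one_div_div]
    have hlt : s * (Q 0 / Q 1) < 2 := by
      have : 2 - s * (Q 0 / Q 1) = Q 2 / Q 1 := by rw [hr]; field_simp
      have : 0 < Q 2 / Q 1 := by positivity
      linarith
    rw [lintegral_pow_W_mul_pow_Z_succ hG n _ (z := ENNReal.ofReal (Q 1 / Q 2))]
    · rw [ih (fun i ↦ Q (i + 1)) (fun i hi ↦ hpos _ (by omega)) (fun i hi ↦ hrec _ (by omega)),
        ← ENNReal.ofReal_mul (by positivity)]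
      congr 1
      field_simp
    · intro k
      rw [← ENNReal.ofReal_mul hs, lintegral_pow_offspring hG n k (by positivity) hlt, e]

theorem lintegral_pow_W [IsProbabilityMeasure μ] (hG : IsOffspringArray μ G) {s : ℝ}
    (hs : 0 ≤ s) (n : ℕ) (Q : ℕ → ℝ) (h0 : Q 0 = 1) (h1 : Q 1 = 1)
    (hpos : ∀ i ≤ n + 1, 0 < Q i) (hrec : ∀ i < n, Q (i + 2) = 2 * Q (i + 1) - s * Q i) :
    ∫⁻ ω, ENNReal.ofReal s ^ W G n ω ∂μ = ENNReal.ofReal (1 / Q (n + 1)) := by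
  simpa [h0, h1] using lintegral_pow_W_mul_pow_Z hG hs n Q hpos hrec

end GeneratingFunction

/-! ### Moment bounds and the Laplace transform limit -/

section Estimates

/-- The reciprocals of the generating functions of `W`: `E s ^ W n = 1 / denom s (n + 1)`. -/
def denom (s : ℝ) : ℕ → ℝ
  | 0 => 1
  | 1 => 1
  | n + 2 => 2 * denom s (n + 1) - s * denom s n

/-- `1 ± r` are the roots of the characteristic equation `λ² = 2λ - (1 - r²)`. -/
lemma denom_one_sub_sq (r : ℝ) (n : ℕ) :
    denom (1 - r ^ 2) n = ((1 + r) ^ n + (1 - r) ^ n) / 2 := by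
  induction n using Nat.twoStepInduction with
  | zero => norm_num [denom]
  | one => norm_num [denom]
  | more n h1 h2 => rw [denom, h1, h2]; ring

/-- For `s = 1 + δ` the second difference of `denom` is `-δ * denom`, which lies in `[-δ, 0]` while
`denom` stays in `[0, 1]`. The increments start at `0`, so they fall at most linearly and `denom` at
most quadratically. -/
lemma denom_one_add_bounds {δ : ℝ} (hδ : 0 ≤ δ) {m : ℕ} (hm : δ * m ^ 2 ≤ 1) :
    ∀ i ≤ m, 1 / 2 ≤ denom (1 + δ) i ∧ denom (1 + δ) i ≤ 1 := by
  have aux : ∀ i, i + 1 ≤ m → (1 - δ * i ^ 2 / 2 ≤ denom (1 + δ) i ∧ denom (1 + δ) i ≤ 1) ∧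
      (denom (1 + δ) (i + 1) ≤ denom (1 + δ) i ∧
        denom (1 + δ) i - δ * i ≤ denom (1 + δ) (i + 1)) := by
    intro i
    induction i with
    | zero => intro _; norm_num [denom]
    | succ i ih =>
      intro hi
      obtain ⟨⟨h1, h2⟩, h3, h4⟩ := ih (by omega)
      have him : (i : ℝ) ^ 2 ≤ m ^ 2 := by
        have : (i : ℝ) ≤ m := by exact_mod_cast (by omega : i ≤ m)
        gcongr
      have hb : δ * (i : ℝ) ^ 2 ≤ 1 := (mul_le_mul_of_nonneg_left him hδ).trans hm
      have e : denom (1 + δ) (i + 1 + 1) =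
        2 * denom (1 + δ) (i + 1) - (1 + δ) * denom (1 + δ) i := rfl
      have h5 : 0 ≤ denom (1 + δ) i := by linarith
      have h6 : δ * denom (1 + δ) i ≤ δ * 1 := mul_le_mul_of_nonneg_left h2 hδ
      have h7 : 0 ≤ δ * denom (1 + δ) i := mul_nonneg hδ h5
      push_cast
      refine ⟨⟨by nlinarith, by linarith⟩, by rw [e]; linarith, by rw [e]; linarith⟩
  intro i hi
  rcases i with _ | i
  · norm_num [denom]
  · obtain ⟨⟨h1, h2⟩, h3, h4⟩ := aux i hi
    have him : ((i : ℝ) + 1) ^ 2 ≤ m ^ 2 := by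
      have : (i : ℝ) + 1 ≤ m := by exact_mod_cast hi
      gcongr
    have hb : δ * ((i : ℝ) + 1) ^ 2 ≤ 1 := (mul_le_mul_of_nonneg_left him hδ).trans hm
    exact ⟨by nlinarith, by linarith⟩

variable {Ω : Type*} {G : ℕ → ℕ → Ω → ℕ} [mΩ : MeasurableSpace Ω] {μ : Measure Ω}
  [IsProbabilityMeasure μ]

lemma lintegral_one_add_pow_W_le (hG : IsOffspringArray μ G) (n : ℕ) :
    ∫⁻ ω, ENNReal.ofReal (1 + 1 / (n + 1) ^ 2) ^ W G n ω ∂μ ≤ 2 := by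
  have hb := denom_one_add_bounds (δ := 1 / ((n : ℝ) + 1) ^ 2) (by positivity) (m := n + 1)
    (by push_cast; rw [one_div_mul_cancel (by positivity)])
  rw [lintegral_pow_W hG (by positivity) n (denom (1 + 1 / ((n : ℝ) + 1) ^ 2)) rfl rfl
    (fun i hi ↦ by linarith [(hb i hi).1]) (fun i _ ↦ rfl)]
  have := (hb (n + 1) le_rfl).1
  rw [← ENNReal.ofReal_ofNat]
  refine ENNReal.ofReal_le_ofReal ?_
  rw [div_le_iff₀ (by linarith)]
  linarith

lemma exp_half_le_one_add {u : ℝ} (h0 : 0 ≤ u) (h1 : u ≤ 1) : Real.exp (u / 2) ≤ 1 + u := by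
  rw [← Real.le_log_iff_exp_le (by linarith)]
  have := Real.one_sub_inv_le_log_of_pos (x := 1 + u) (by linarith)
  refine le_trans ?_ this
  have : 1 - (1 + u)⁻¹ = u / (1 + u) := by field_simp; ring
  rw [this]
  gcongr
  linarith

/-- Polynomial tail bounds, of every order, for `W n / n ^ 2`, uniformly in `n`. -/
lemma exists_measure_lt_W_le (hG : IsOffspringArray μ G) (q : ℕ) : ∃ C : ℝ, 0 < C ∧
    ∀ n : ℕ, ∀ x : ℝ, 0 < x →
      μ {ω | x < (W G n ω : ℝ)} ≤ ENNReal.ofReal (C * ((n : ℝ) ^ 2 / x) ^ q) := by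
  -- Markov's inequality: `2` bounds the exponential moment, `q!` comes from `y^q / q! ≤ e^y`, and
  -- `8` combines `e^(u/2) ≤ 1 + u` with `(n + 1)² ≤ 4n²`.
  refine ⟨2 * q.factorial * 8 ^ q, by positivity, fun n x hx ↦ ?_⟩
  rcases Nat.eq_zero_or_pos n with rfl | hn
  · simp [W, not_lt.2 hx.le]
  set u : ℝ := 1 / (n + 1) ^ 2 with hu
  have hn1 : (1 : ℝ) ≤ n := by exact_mod_cast hn
  have hu0 : 0 < u := by positivity
  have hu1 : u ≤ 1 := by rw [hu, div_le_one (by positivity)]; nlinarith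
  have hpow (a : ℝ≥0∞) : Measurable fun j : ℕ ↦ a ^ j := measurable_of_countable _
  have hc : 0 < (u * x / 2) ^ q / q.factorial := by positivity
  have hsub : {ω | x < (W G n ω : ℝ)} ⊆
      {ω | ENNReal.ofReal ((u * x / 2) ^ q / q.factorial) ≤ ENNReal.ofReal (1 + u) ^ W G n ω} := by
    intro ω hω
    simp only [Set.mem_ofPred_eq] at hω ⊢
    rw [← ENNReal.ofReal_pow (by positivity)]
    refine ENNReal.ofReal_le_ofReal ?_
    calc (u * x / 2) ^ q / q.factorial ≤ Real.exp (u * x / 2) :=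
          Real.pow_div_factorial_le_exp _ (by positivity) _
      _ ≤ Real.exp (W G n ω * (u / 2)) := by
          refine Real.exp_le_exp.2 ?_
          nlinarith
      _ = Real.exp (u / 2) ^ W G n ω := Real.exp_nat_mul _ _
      _ ≤ _ := pow_le_pow_left₀ (Real.exp_pos _).le (exp_half_le_one_add hu0.le hu1) _
  calc μ {ω | x < (W G n ω : ℝ)} ≤ _ := measure_mono hsub
    _ ≤ (∫⁻ ω, ENNReal.ofReal (1 + u) ^ W G n ω ∂μ) /
        ENNReal.ofReal ((u * x / 2) ^ q / q.factorial) :=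
      meas_ge_le_lintegral_div ((hpow _).comp (measurable_W hG n)).aemeasurable
        (by simpa using hc) ENNReal.ofReal_ne_top
    _ ≤ 2 / ENNReal.ofReal ((u * x / 2) ^ q / q.factorial) :=
      ENNReal.div_le_div_right (lintegral_one_add_pow_W_le hG n) _
    _ = ENNReal.ofReal (2 / ((u * x / 2) ^ q / q.factorial)) := by
      rw [ENNReal.ofReal_div_of_pos hc, ENNReal.ofReal_ofNat]
    _ ≤ _ := by
      refine ENNReal.ofReal_le_ofReal ?_
      have h4 : 1 / u ≤ 4 * (n : ℝ) ^ 2 := by rw [hu, one_div_one_div]; nlinarith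
      have e : 2 / ((u * x / 2) ^ q / q.factorial) =
          2 * q.factorial * (2 * (1 / u) / x) ^ q := by
        rw [div_div_eq_mul_div, div_eq_mul_inv, ← inv_pow]
        congr 2
        field_simp
      have h8 : 2 * (1 / u) ≤ 8 * (n : ℝ) ^ 2 := by linarith
      have h9 : 2 * (1 / u) / x ≤ 8 * ((n : ℝ) ^ 2 / x) :=
        (div_le_div_of_nonneg_right h8 hx.le).trans_eq (mul_div_assoc _ _ _)
      rw [e, mul_assoc _ ((8 : ℝ) ^ q), ← mul_pow]
      exact mul_le_mul_of_nonneg_left (pow_le_pow_left₀ (by positivity) h9 q) (by positivity)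

lemma integral_exp_neg_mul_W (hG : IsOffspringArray μ G) {a : ℝ} (ha : 0 ≤ a) (n : ℕ) :
    ∫ ω, Real.exp (-a * W G n ω) ∂μ =
      2 / ((1 + √(1 - Real.exp (-a))) ^ (n + 1) + (1 - √(1 - Real.exp (-a))) ^ (n + 1)) := by
  have hs1 : Real.exp (-a) ≤ 1 := Real.exp_le_one_iff.2 (by linarith)
  set r := √(1 - Real.exp (-a)) with hr
  have hsq : r ^ 2 = 1 - Real.exp (-a) := Real.sq_sqrt (by linarith)
  have hr0 : 0 ≤ r := Real.sqrt_nonneg _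
  have hr1 : r < 1 := by nlinarith [Real.exp_pos (-a)]
  have hden (i : ℕ) : denom (Real.exp (-a)) i = ((1 + r) ^ i + (1 - r) ^ i) / 2 := by
    rw [← denom_one_sub_sq, hsq]; ring_nf
  have hpos (i : ℕ) : 0 < denom (Real.exp (-a)) i := by
    rw [hden]
    have : 0 < 1 - r := by linarith
    positivity
  rw [integral_eq_lintegral_of_nonneg_ae (ae_of_all _ fun ω ↦ (Real.exp_pos _).le)
    (by have := measurable_W hG n; fun_prop)]
  have e (ω : Ω) : ENNReal.ofReal (Real.exp (-a * W G n ω)) =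
      ENNReal.ofReal (Real.exp (-a)) ^ W G n ω := by
    rw [← ENNReal.ofReal_pow (Real.exp_pos _).le, ← Real.exp_nat_mul, mul_comm]
  simp only [e]
  rw [lintegral_pow_W hG (Real.exp_pos _).le n _ rfl rfl (fun i _ ↦ hpos i) (fun i _ ↦ rfl),
    ENNReal.toReal_ofReal (by have := hpos (n + 1); positivity), hden, one_div_div]

/-- The bounds `r/(1+r) ≤ log(1+r) ≤ r` hold for either sign of `r`, so both roots `1 ± r` are
covered. -/
lemma tendsto_one_add_pow_exp {ι : Type*} {l : Filter ι} {r : ι → ℝ} {N : ι → ℕ} {t : ℝ}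
    (hr : Tendsto r l (𝓝 0)) (h : Tendsto (fun i ↦ N i * r i) l (𝓝 t)) :
    Tendsto (fun i ↦ (1 + r i) ^ N i) l (𝓝 (Real.exp t)) := by
  have hpos : ∀ᶠ i in l, 0 < 1 + r i := by
    filter_upwards [hr.eventually (lt_mem_nhds (show (-1 : ℝ) < 0 by norm_num))] with i hi
    linarith
  have hlog : Tendsto (fun i ↦ N i * Real.log (1 + r i)) l (𝓝 t) := by
    have h1 : Tendsto (fun i ↦ N i * r i / (1 + r i)) l (𝓝 t) := by
      have := h.div (tendsto_const_nhds.add hr) (by norm_num : (1 : ℝ) + 0 ≠ 0)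
      rwa [add_zero, div_one] at this
    refine tendsto_of_tendsto_of_tendsto_of_le_of_le' h1 h ?_ ?_
    · filter_upwards [hpos] with i hi
      have := Real.one_sub_inv_le_log_of_pos hi
      rw [mul_div_assoc]
      refine mul_le_mul_of_nonneg_left (le_trans (le_of_eq ?_) this) (Nat.cast_nonneg _)
      field_simp; ring
    · filter_upwards [hpos] with i hi
      have := Real.log_le_sub_one_of_pos hi
      exact mul_le_mul_of_nonneg_left (by linarith) (Nat.cast_nonneg _)
  refine ((Real.continuous_exp.tendsto t).comp hlog).congr' ?_
  filter_upwards [hpos] with i hi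
  simp only [Function.comp]
  rw [Real.exp_nat_mul, Real.exp_log hi]

lemma tendsto_mul_one_sub_exp_neg_div (u : ℝ) :
    Tendsto (fun x : ℝ ↦ x * (1 - Real.exp (-(u / x)))) atTop (𝓝 u) := by
  have hd : HasDerivAt (fun y : ℝ ↦ 1 - Real.exp (-(u * y))) u 0 := by
    have := ((((hasDerivAt_id (0 : ℝ)).const_mul u).neg).exp).const_sub 1
    simpa using this
  have h := hd.tendsto_slope_zero_right.comp tendsto_inv_atTop_nhdsGT_zero
  refine h.congr fun x ↦ ?_
  simp [div_eq_mul_inv]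

/-- Convergence of the Laplace transform of `W n / x` when `n` is asymptotic to `b √x`. -/
lemma tendsto_integral_exp_neg_W (hG : IsOffspringArray μ G) {N : ℝ → ℕ} {b u : ℝ} (hu : 0 ≤ u)
    (hN : Tendsto (fun x ↦ N x / √x) atTop (𝓝 b)) :
    Tendsto (fun x : ℝ ↦ ∫ ω, Real.exp (-(u / x) * W G (N x) ω) ∂μ) atTop
      (𝓝 (1 / Real.cosh (b * √u))) := by
  set r : ℝ → ℝ := fun x ↦ √(1 - Real.exp (-(u / x))) with hr
  have h1 : Tendsto (fun x ↦ √x * r x) atTop (𝓝 √u) := by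
    refine ((Real.continuous_sqrt.tendsto u).comp (tendsto_mul_one_sub_exp_neg_div u)).congr' ?_
    filter_upwards [eventually_ge_atTop 0] with x hx
    simp only [Function.comp, hr]
    rw [Real.sqrt_mul hx]
  have hsq : Tendsto (fun x : ℝ ↦ (√x)⁻¹) atTop (𝓝 0) :=
    tendsto_inv_atTop_zero.comp Real.tendsto_sqrt_atTop
  have hr0 : Tendsto r atTop (𝓝 0) := by
    have := h1.mul hsq
    rw [mul_zero] at this
    refine this.congr' ?_
    filter_upwards [eventually_gt_atTop 0] with x hx
    have : √x ≠ 0 := (Real.sqrt_pos.2 hx).ne'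
    field_simp
  have hNr : Tendsto (fun x ↦ ((N x + 1 : ℕ) : ℝ) * r x) atTop (𝓝 (b * √u)) := by
    have := (hN.mul h1).add hr0
    rw [add_zero] at this
    refine this.congr' ?_
    filter_upwards [eventually_gt_atTop 0] with x hx
    have : √x ≠ 0 := (Real.sqrt_pos.2 hx).ne'
    push_cast
    field_simp
  have hp := tendsto_one_add_pow_exp hr0 hNr
  have hm := tendsto_one_add_pow_exp (r := fun x ↦ - r x) (by simpa using hr0.neg)
    (N := fun x ↦ N x + 1) (t := -(b * √u)) (by simpa only [mul_neg] using hNr.neg)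
  have hlim := (tendsto_const_nhds (x := (2 : ℝ))).div (hp.add hm) (by positivity)
  have e : 2 / (Real.exp (b * √u) + Real.exp (-(b * √u))) = 1 / Real.cosh (b * √u) := by
    rw [Real.cosh_eq, one_div_div]
  rw [e] at hlim
  refine hlim.congr' ?_
  filter_upwards [eventually_gt_atTop 0] with x hx
  rw [integral_exp_neg_mul_W hG (by positivity)]
  simp [hr, sub_eq_add_neg]

end Estimates

/-! ### From Laplace transforms to weak convergence, via `e^(-X)` on the unit interval -/

section WeakConvergence

/-- The method of moments on the unit interval. -/
lemma tendsto_of_tendsto_integral_pow {ι : Type*} {l : Filter ι} {ρ : ι → ProbabilityMeasure I}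
    {ρ₀ : ProbabilityMeasure I}
    (h : ∀ k : ℕ, Tendsto (fun i ↦ ∫ t : I, (t : ℝ) ^ k ∂(ρ i : Measure I)) l
      (𝓝 (∫ t : I, (t : ℝ) ^ k ∂(ρ₀ : Measure I)))) : Tendsto ρ l (𝓝 ρ₀) := by
  rw [ProbabilityMeasure.tendsto_iff_forall_integral_tendsto]
  intro f
  have hint (ρ : ProbabilityMeasure I) (g : C(I, ℝ)) : Integrable g (ρ : Measure I) :=
    g.continuous.integrable_of_hasCompactSupport
      (HasCompactSupport.of_compactSpace _)
  have hpoly (p : Polynomial ℝ) : Tendsto (fun i ↦ ∫ t : I, p.eval (t : ℝ) ∂(ρ i : Measure I)) l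
      (𝓝 (∫ t : I, p.eval (t : ℝ) ∂(ρ₀ : Measure I))) := by
    have e (ρ : ProbabilityMeasure I) : ∫ t : I, p.eval (t : ℝ) ∂(ρ : Measure I) =
        ∑ k ∈ Finset.range (p.natDegree + 1), p.coeff k * ∫ t : I, (t : ℝ) ^ k ∂(ρ : Measure I) := by
      simp only [Polynomial.eval_eq_sum_range]
      rw [integral_finsetSum]
      · simp only [integral_const_mul]
      · exact fun k _ ↦ (hint ρ ⟨fun t : I ↦ (t : ℝ) ^ k, by fun_prop⟩).const_mul _
    simp only [e]
    exact tendsto_finsetSum _ fun k _ ↦ (h k).const_mul _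
  rw [Metric.tendsto_nhds]
  intro ε hε
  obtain ⟨p, hp⟩ := exists_polynomial_near_continuousMap 0 1 f.toContinuousMap (ε / 3)
    (by positivity)
  have hclose (ρ : ProbabilityMeasure I) :
      |∫ t : I, p.eval (t : ℝ) ∂(ρ : Measure I) - ∫ t, f t ∂(ρ : Measure I)| ≤ ε / 3 := by
    have hp' : Integrable (fun t : I ↦ p.eval (t : ℝ)) (ρ : Measure I) :=
      hint ρ ⟨fun t : I ↦ p.eval (t : ℝ), by fun_prop⟩
    have hf' : Integrable (fun t ↦ f t) (ρ : Measure I) := hint ρ f.toContinuousMap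
    rw [← integral_sub hp' hf']
    have := norm_integral_le_of_norm_le_const (μ := (ρ : Measure I)) (C := ε / 3)
      (f := fun t : I ↦ p.eval (t : ℝ) - f t)
      (ae_of_all _ fun t ↦ ((ContinuousMap.norm_coe_le_norm _ t).trans hp.le :))
    simpa using this
  filter_upwards [Metric.tendsto_nhds.1 (hpoly p) (ε / 3) (by positivity)] with i hi
  rw [Real.dist_eq] at hi ⊢
  have h1 := abs_le.1 (hclose (ρ i))
  have h2 := abs_le.1 (hclose ρ₀)
  have h3 := abs_lt.1 hi
  exact abs_lt.2 ⟨by linarith [h1.1, h2.2, h3.1], by linarith [h1.2, h2.1, h3.2]⟩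

/-- The map `t ↦ e^{-t}` from `[0, ∞)` to the unit interval, constant on `(-∞, 0]`. -/
noncomputable def expNeg (t : ℝ) : I := Set.projIcc 0 1 zero_le_one (Real.exp (-t))

lemma continuous_expNeg : Continuous expNeg :=
  continuous_projIcc.comp (by fun_prop)

lemma coe_expNeg {t : ℝ} (ht : 0 ≤ t) : (expNeg t : ℝ) = Real.exp (-t) := by
  rw [expNeg, Set.projIcc_of_mem zero_le_one ⟨(Real.exp_pos _).le, Real.exp_le_one_iff.2 (by simpa)⟩]

variable {Ω Ω' : Type*} [MeasurableSpace Ω] [MeasurableSpace Ω'] {μ : Measure Ω}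
  [IsProbabilityMeasure μ] {ν : Measure Ω'} [IsProbabilityMeasure ν]

lemma measurable_expNeg_comp {X : Ω → ℝ} (hX : Measurable X) :
    Measurable fun ω ↦ expNeg (X ω) :=
  continuous_expNeg.measurable.comp hX

/-- The law of `e^{-X}`. -/
noncomputable def expNegLaw (μ : Measure Ω) [IsProbabilityMeasure μ] {X : Ω → ℝ}
    (hX : Measurable X) : ProbabilityMeasure I :=
  ⟨μ.map fun ω ↦ expNeg (X ω),
    Measure.isProbabilityMeasure_map (measurable_expNeg_comp hX).aemeasurable⟩

/-- Integer exponents suffice for convergence; real ones serve to identify the full Laplace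
transform of the limit. -/
lemma integral_expNegLaw {X : Ω → ℝ} (hX : Measurable X) (h0 : ∀ᵐ ω ∂μ, 0 ≤ X ω) (u : ℝ) :
    ∫ t : I, (t : ℝ) ^ u ∂(expNegLaw μ hX : Measure I) =
      ∫ ω, Real.exp (-u * X ω) ∂μ := by
  simp only [expNegLaw, ProbabilityMeasure.coe_mk]
  rw [integral_map (measurable_expNeg_comp hX).aemeasurable
    (by have : Measurable fun t : I ↦ (t : ℝ) ^ u := by fun_prop
        exact this.aestronglyMeasurable)]
  refine integral_congr_ae ?_
  filter_upwards [h0] with ω hω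
  rw [coe_expNeg hω, ← Real.exp_mul]
  ring_nf

lemma expNegLaw_Iic {X : Ω → ℝ} (hX : Measurable X) (h0 : ∀ᵐ ω ∂μ, 0 ≤ X ω) (a : ℝ) :
    (expNegLaw μ hX : Measure I) {t | (t : ℝ) ≤ Real.exp (-a)} = μ {ω | a ≤ X ω} := by
  simp only [expNegLaw, ProbabilityMeasure.coe_mk]
  rw [Measure.map_apply (measurable_expNeg_comp hX)
    (measurableSet_le (by fun_prop) (by fun_prop))]
  refine measure_congr ?_
  filter_upwards [h0] with ω hω
  refine propext ?_
  change (expNeg (X ω) : ℝ) ≤ Real.exp (-a) ↔ a ≤ X ω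
  rw [coe_expNeg hω, Real.exp_le_exp, neg_le_neg_iff]

lemma expNegLaw_Iio {X : Ω → ℝ} (hX : Measurable X) (h0 : ∀ᵐ ω ∂μ, 0 ≤ X ω) (a : ℝ) :
    (expNegLaw μ hX : Measure I) {t | (t : ℝ) < Real.exp (-a)} = μ {ω | a < X ω} := by
  simp only [expNegLaw, ProbabilityMeasure.coe_mk]
  rw [Measure.map_apply (measurable_expNeg_comp hX)
    (measurableSet_lt (by fun_prop) (by fun_prop))]
  refine measure_congr ?_
  filter_upwards [h0] with ω hω
  refine propext ?_
  change (expNeg (X ω) : ℝ) < Real.exp (-a) ↔ a < X ω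
  rw [coe_expNeg hω, Real.exp_lt_exp, neg_lt_neg_iff]

/-- Convergence of Laplace transforms of nonnegative random variables implies weak convergence. -/
lemma tendsto_expNegLaw {ι : Type*} {l : Filter ι} {X : ι → Ω → ℝ} {Y : Ω' → ℝ}
    (hX : ∀ i, Measurable (X i)) (hY : Measurable Y)
    (hX0 : ∀ᶠ i in l, ∀ᵐ ω ∂μ, 0 ≤ X i ω) (hY0 : ∀ᵐ ω ∂ν, 0 ≤ Y ω)
    (h : ∀ k : ℕ, Tendsto (fun i ↦ ∫ ω, Real.exp (-k * X i ω) ∂μ) l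
      (𝓝 (∫ ω, Real.exp (-k * Y ω) ∂ν))) :
    Tendsto (fun i ↦ expNegLaw μ (hX i)) l (𝓝 (expNegLaw ν hY)) := by
  refine tendsto_of_tendsto_integral_pow fun k ↦ ?_
  have e1 := integral_expNegLaw (μ := ν) hY hY0 k
  simp only [Real.rpow_natCast] at e1
  rw [e1]
  refine (h k).congr' ?_
  filter_upwards [hX0] with i hi
  have e2 := integral_expNegLaw (μ := μ) (hX i) hi k
  simp only [Real.rpow_natCast] at e2
  exact e2.symm

end WeakConvergence

/-! ### Existence of `ϑ` and convergence of `W n / x` -/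

section Limit

variable {Ω : Type*} {G : ℕ → ℕ → Ω → ℕ} [mΩ : MeasurableSpace Ω] {μ : Measure Ω}

lemma measurable_W_div (hG : IsOffspringArray μ G) (n : ℕ) (x : ℝ) :
    Measurable fun ω ↦ (W G n ω : ℝ) / x := by
  have := measurable_W hG n
  fun_prop

variable [IsProbabilityMeasure μ]

/-- On `t ≤ 0` one has `e^(-st) ≥ 1`, so this event has mass at most `1/cosh √s`, which vanishes as
`s → ∞`. -/
lemma IsVarthetaLaw.ae_pos {ν : Measure ℝ} (hν : IsVarthetaLaw ν) : ∀ᵐ t ∂ν, 0 < t := by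
  have hle (s : ℝ) (hs : 0 ≤ s) : ν {t | ¬ 0 < t} ≤ ENNReal.ofReal (1 / Real.cosh √s) := by
    have hpos : 0 < 1 / Real.cosh √s := by have := Real.cosh_pos √s; positivity
    have hi : Integrable (fun t ↦ Real.exp (-s * t)) ν := by
      by_contra h
      have := integral_undef h
      rw [hν.laplace s hs] at this
      exact hpos.ne' this
    rw [← hν.laplace s hs, ofReal_integral_eq_lintegral_ofReal hi
      (ae_of_all _ fun t ↦ (Real.exp_pos _).le)]
    have hm : MeasurableSet {t : ℝ | ¬ 0 < t} := (measurableSet_lt measurable_const measurable_id).compl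
    rw [← lintegral_indicator_one hm]
    refine lintegral_mono fun t ↦ ?_
    by_cases ht : t ∈ {t : ℝ | ¬ 0 < t}
    · rw [Set.indicator_of_mem ht, Pi.one_apply, ENNReal.one_le_ofReal, Real.one_le_exp_iff]
      have : t ≤ 0 := not_lt.1 ht
      nlinarith
    · rw [Set.indicator_of_notMem ht]; exact zero_le
  have hlim : Tendsto (fun s : ℝ ↦ ENNReal.ofReal (1 / Real.cosh √s)) atTop (𝓝 0) := by
    rw [← ENNReal.ofReal_zero]
    refine (ENNReal.continuous_ofReal.tendsto 0).comp ?_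
    simp only [one_div]
    refine tendsto_inv_atTop_zero.comp ?_
    refine tendsto_atTop_mono (fun s ↦ ?_) Real.tendsto_sqrt_atTop
    rw [Real.cosh_eq]
    have h1 := Real.quadratic_le_exp_of_nonneg (Real.sqrt_nonneg s)
    have h2 := Real.add_one_le_exp (-√s)
    nlinarith [sq_nonneg (√s - 1), Real.exp_pos (-√s)]
  rw [ae_iff]
  refine le_antisymm (ge_of_tendsto hlim ?_) zero_le
  filter_upwards [eventually_ge_atTop 0] with s hs using hle s hs

lemma tendsto_floor_mul_sqrt_div {b : ℝ} (hb : 0 ≤ b) :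
    Tendsto (fun x : ℝ ↦ (⌊b * √x⌋₊ : ℝ) / √x) atTop (𝓝 b) :=
  (tendsto_nat_floor_mul_div_atTop hb).comp Real.tendsto_sqrt_atTop

theorem exists_isVarthetaLaw (hG : IsOffspringArray μ G) : ∃ ν : Measure ℝ, IsVarthetaLaw ν := by
  set ρ : ℝ → ProbabilityMeasure I := fun x ↦
    expNegLaw μ (measurable_W_div hG ⌊1 * √x⌋₊ x) with hρ
  -- Probability measures on the unit interval form a compact space, so the laws of `e^(-W/x)`
  -- converge along an ultrafilter.
  set V : Ultrafilter ℝ := Ultrafilter.of atTop with hV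
  set ρ₀ : ProbabilityMeasure I := (V.map ρ).lim with hρ₀
  have hlim : Tendsto ρ V (𝓝 ρ₀) := (V.map ρ).le_nhds_lim
  have hVle : (V : Filter ℝ) ≤ atTop := Ultrafilter.of_le _
  have hmom (u : ℝ) (hu : 0 < u) :
      ∫ t : I, (t : ℝ) ^ u ∂(ρ₀ : Measure I) = 1 / Real.cosh √u := by
    let f : BoundedContinuousFunction I ℝ :=
      BoundedContinuousFunction.mkOfCompact
        ⟨fun t ↦ (t : ℝ) ^ u, (Real.continuous_rpow_const hu.le).comp continuous_subtype_val⟩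
    have h1 := ProbabilityMeasure.tendsto_iff_forall_integral_tendsto.1 hlim f
    have h2 := (tendsto_integral_exp_neg_W hG hu.le
      (tendsto_floor_mul_sqrt_div zero_le_one)).mono_left hVle
    rw [one_mul] at h2
    refine tendsto_nhds_unique h1 (h2.congr' ?_)
    filter_upwards [hVle (Ioi_mem_atTop (0 : ℝ))] with x hx
    have hx' : 0 < x := hx
    have := integral_expNegLaw (μ := μ) (measurable_W_div hG ⌊1 * √x⌋₊ x)
      (ae_of_all _ fun ω ↦ by positivity) u
    refine Eq.trans ?_ this.symm
    congr 1 with ω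
    ring_nf
  have hmeas : MeasurableSet {t : I | (t : ℝ) ≠ 0} :=
    (measurableSet_eq_fun (by fun_prop) (by fun_prop)).compl
  -- Letting `u → 0` in this bound shows that the limit has no atom at `0`, that is, no mass of
  -- `W/x` escapes to infinity.
  have hle (u : ℝ) (hu : 0 < u) :
      1 / Real.cosh √u ≤ (ρ₀ : Measure I).real {t : I | (t : ℝ) ≠ 0} := by
    rw [← hmom u hu, ← integral_indicator_one hmeas]
    refine integral_mono_of_nonneg (ae_of_all _ fun t ↦ by have := t.2.1; positivity)
      ((integrable_const (1 : ℝ)).indicator hmeas) (ae_of_all _ fun t ↦ ?_)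
    by_cases ht : (t : ℝ) = 0
    · simp only [ht, Real.zero_rpow hu.ne']
      exact Set.indicator_nonneg (fun _ _ ↦ zero_le_one) _
    · simp only [Set.indicator, Set.mem_ofPred_eq, ne_eq, ht, not_false_eq_true, if_true]
      exact Real.rpow_le_one t.2.1 t.2.2 hu.le
  have hone : 1 ≤ (ρ₀ : Measure I).real {t : I | (t : ℝ) ≠ 0} := by
    have hc : Continuous fun u : ℝ ↦ 1 / Real.cosh √u :=
      continuous_const.div (Real.continuous_cosh.comp Real.continuous_sqrt)
        fun u ↦ (Real.cosh_pos _).ne'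
    have ht : Tendsto (fun u : ℝ ↦ 1 / Real.cosh √u) (𝓝[>] 0) (𝓝 1) := by
      have := hc.tendsto 0
      simp only [Real.sqrt_zero, Real.cosh_zero, div_one] at this
      exact this.mono_left nhdsWithin_le_nhds
    exact le_of_tendsto ht (eventually_mem_nhdsWithin.mono fun u hu ↦ hle u hu)
  have hae : ∀ᵐ t : I ∂(ρ₀ : Measure I), (t : ℝ) ≠ 0 := by
    refine (prob_compl_eq_zero_iff hmeas).2 (le_antisymm prob_le_one ?_)
    rw [← ENNReal.ofReal_one]
    exact (ENNReal.ofReal_le_ofReal hone).trans_eq ofReal_measureReal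
  have hlogm : Measurable fun t : I ↦ -Real.log (t : ℝ) := by fun_prop
  refine ⟨(ρ₀ : Measure I).map fun t : I ↦ -Real.log (t : ℝ),
    Measure.isProbabilityMeasure_map hlogm.aemeasurable, fun s hs ↦ ?_⟩
  rw [integral_map hlogm.aemeasurable (by fun_prop)]
  rcases hs.eq_or_lt with rfl | hs
  · simp
  rw [← hmom s hs]
  refine integral_congr_ae ?_
  filter_upwards [hae] with t ht
  rw [Real.rpow_def_of_pos (lt_of_le_of_ne t.2.1 (Ne.symm ht))]
  ring_nf

lemma tendsto_expNegLaw_W (hG : IsOffspringArray μ G) {ν : Measure ℝ} (hν : IsVarthetaLaw ν)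
    [IsProbabilityMeasure ν] {N : ℝ → ℕ} {b : ℝ} (hb : 0 ≤ b)
    (hN : Tendsto (fun x ↦ N x / √x) atTop (𝓝 b)) :
    Tendsto (fun x ↦ expNegLaw μ (measurable_W_div hG (N x) x)) atTop
      (𝓝 (expNegLaw ν (measurable_id.const_mul (b ^ 2)))) := by
  refine tendsto_expNegLaw _ _ ?_ ?_ fun k ↦ ?_
  · filter_upwards [eventually_gt_atTop 0] with x hx
    exact ae_of_all _ fun ω ↦ by positivity
  · filter_upwards [hν.ae_pos] with t ht
    exact mul_nonneg (sq_nonneg b) ht.le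
  · have h := tendsto_integral_exp_neg_W hG (Nat.cast_nonneg k) hN
    have e : ∫ t, Real.exp (-k * (b ^ 2 * id t)) ∂ν = 1 / Real.cosh (b * √k) := by
      have := hν.laplace (b ^ 2 * k) (by positivity)
      rw [Real.sqrt_mul (sq_nonneg b), Real.sqrt_sq hb] at this
      rw [← this]
      congr 1 with t
      simp only [id]
      ring_nf
    rw [e]
    refine h.congr fun x ↦ ?_
    congr 1 with ω
    ring_nf

/-- Portmanteau for a closed set here and for an open set in `le_liminf_measure_lt_W`; a possible
atom of `b²ϑ` at `1` separates the two bounds. -/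
theorem limsup_measure_le_W (hG : IsOffspringArray μ G) {ν : Measure ℝ} (hν : IsVarthetaLaw ν)
    {N : ℝ → ℕ} {b : ℝ} (hb : 0 ≤ b) (hN : Tendsto (fun x ↦ N x / √x) atTop (𝓝 b)) :
    limsup (fun x : ℝ ↦ μ {ω | x < (W G (N x) ω : ℝ)}) atTop ≤ ν {t | 1 ≤ b ^ 2 * t} := by
  have := hν.isProbabilityMeasure
  have h := ProbabilityMeasure.limsup_measure_closed_le_of_tendsto
    (tendsto_expNegLaw_W hG hν hb hN) (F := {t : I | (t : ℝ) ≤ Real.exp (-1)})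
    (isClosed_le (by fun_prop) (by fun_prop))
  rw [expNegLaw_Iic _ (hν.ae_pos.mono fun t ht ↦ mul_nonneg (sq_nonneg b) ht.le)] at h
  refine le_trans (limsup_le_limsup ?_) h
  filter_upwards [eventually_gt_atTop 0] with x hx
  rw [expNegLaw_Iic _ (ae_of_all _ fun ω ↦ by positivity)]
  refine measure_mono fun ω hω ↦ ?_
  exact (one_le_div hx).2 (le_of_lt hω)

theorem le_liminf_measure_lt_W (hG : IsOffspringArray μ G) {ν : Measure ℝ} (hν : IsVarthetaLaw ν)
    {N : ℝ → ℕ} {b : ℝ} (hb : 0 ≤ b) (hN : Tendsto (fun x ↦ N x / √x) atTop (𝓝 b)) :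
    ν {t | 1 < b ^ 2 * t} ≤ liminf (fun x : ℝ ↦ μ {ω | x < (W G (N x) ω : ℝ)}) atTop := by
  have := hν.isProbabilityMeasure
  have h := ProbabilityMeasure.le_liminf_measure_open_of_tendsto
    (tendsto_expNegLaw_W hG hν hb hN) (G := {t : I | (t : ℝ) < Real.exp (-1)})
    (isOpen_lt (by fun_prop) (by fun_prop))
  rw [expNegLaw_Iio _ (hν.ae_pos.mono fun t ht ↦ mul_nonneg (sq_nonneg b) ht.le)] at h
  refine le_trans h (liminf_le_liminf ?_)
  filter_upwards [eventually_gt_atTop 0] with x hx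
  rw [expNegLaw_Iio _ (ae_of_all _ fun ω ↦ by positivity)]
  refine measure_mono fun ω hω ↦ ?_
  exact (one_lt_div hx).1 hω

end Limit

/-! ### Regularly varying tails and a Potter bound -/

section RegularVariation

variable {F ℓ : ℝ → ℝ} {β : ℝ}

lemma SlowlyVarying.eventually_pos (hℓ : SlowlyVarying ℓ) : ∀ᶠ x in atTop, 0 < ℓ x := by
  obtain ⟨a, ha, -⟩ := hℓ.pos_measurable
  filter_upwards [eventually_ge_atTop a] with x hx using ha x hx

lemma pos_of_isEquivalent_rpow_mul (hF : Antitone F) (hℓ : SlowlyVarying ℓ)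
    (h : F ~[atTop] fun x ↦ x ^ β * ℓ x) (x : ℝ) : 0 < F x := by
  obtain ⟨φ, hφ, hEq⟩ := h.exists_eq_mul
  obtain ⟨y, h1, h2, h3, h4, h5⟩ := (((hφ.eventually (lt_mem_nhds zero_lt_one)).and
    (hEq.and (hℓ.eventually_pos.and
      ((eventually_gt_atTop 0).and (eventually_ge_atTop x)))))).exists
  refine lt_of_lt_of_le ?_ (hF h5)
  rw [h2]
  exact mul_pos h1 (mul_pos (Real.rpow_pos_of_pos h4 _) h3)

lemma tendsto_div_of_isEquivalent_rpow_mul (hℓ : SlowlyVarying ℓ)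
    (h : F ~[atTop] fun x ↦ x ^ β * ℓ x) {y : ℝ} (hy : 0 < y) :
    Tendsto (fun x ↦ F (y * x) / F x) atTop (𝓝 (y ^ β)) := by
  have hmul : Tendsto (fun x : ℝ ↦ y * x) atTop atTop := tendsto_id.const_mul_atTop hy
  have h1 : (fun x ↦ F (y * x) / F x) ~[atTop]
      fun x ↦ ((y * x) ^ β * ℓ (y * x)) / (x ^ β * ℓ x) := (h.comp_tendsto hmul).div h
  refine h1.symm.tendsto_nhds ?_
  have h2 := (hℓ.tendsto_ratio y hy).const_mul (y ^ β)
  rw [mul_one] at h2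
  refine h2.congr' ?_
  filter_upwards [eventually_gt_atTop 0, hℓ.eventually_pos] with x hx hl
  have := Real.rpow_pos_of_pos hx β
  rw [Real.mul_rpow hy.le hx.le]
  field_simp

/-- A Potter-type bound for nonincreasing regularly varying functions, valid on all of
`(0, ∞)`. -/
lemma exists_potter_bound (hF : Antitone F) (hF1 : ∀ x, F x ≤ 1) (hℓ : SlowlyVarying ℓ)
    (h : F ~[atTop] fun x ↦ x ^ β * ℓ x) : ∃ p : ℕ, 0 < p ∧ ∃ C : ℝ, 0 < C ∧
    ∀ t X : ℝ, 0 < t → 0 < X → F t ≤ C * (1 + (X / t) ^ p) * F X := by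
  have hpos := pos_of_isEquivalent_rpow_mul hF hℓ h
  have hlim := tendsto_div_of_isEquivalent_rpow_mul hℓ h (y := 1 / 2) (by norm_num)
  obtain ⟨X₀, hX₀⟩ := eventually_atTop.1
    (hlim.eventually (gt_mem_nhds (lt_add_one ((1 / 2 : ℝ) ^ β))))
  -- One power of `2` dominates both the halving ratio beyond `X₀` and `1 / F X₀`, so the halving
  -- inequality holds for every `X` and can be iterated.
  obtain ⟨p, hp⟩ := pow_unbounded_of_one_lt (max ((1 / 2 : ℝ) ^ β + 1) (1 / F X₀)) one_lt_two
  have hp' : max ((1 / 2 : ℝ) ^ β + 1) (1 / F X₀) ≤ 2 ^ (p + 1) :=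
    hp.le.trans (pow_le_pow_right₀ one_le_two p.le_succ)
  have hdouble (X : ℝ) : F (X / 2) ≤ 2 ^ (p + 1) * F X := by
    rcases le_total X₀ X with hX | hX
    · have h1 := hX₀ X hX
      rw [div_lt_iff₀ (hpos X), one_div_mul_eq_div] at h1
      exact h1.le.trans (mul_le_mul_of_nonneg_right ((le_max_left _ _).trans hp') (hpos X).le)
    · calc F (X / 2) ≤ 1 := hF1 _
        _ = 1 / F X₀ * F X₀ := (one_div_mul_cancel (hpos X₀).ne').symm
        _ ≤ 2 ^ (p + 1) * F X := mul_le_mul ((le_max_right _ _).trans hp') (hF hX)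
          (hpos _).le (by positivity)
  have hiter (k : ℕ) (X : ℝ) : F (X / 2 ^ k) ≤ (2 ^ k) ^ (p + 1) * F X := by
    induction k with
    | zero => simp
    | succ k ih =>
      calc F (X / 2 ^ (k + 1)) = F (X / 2 ^ k / 2) := by rw [pow_succ, div_div]
        _ ≤ 2 ^ (p + 1) * F (X / 2 ^ k) := hdouble _
        _ ≤ 2 ^ (p + 1) * ((2 ^ k) ^ (p + 1) * F X) := by gcongr
        _ = _ := by rw [← mul_assoc, ← mul_pow, pow_succ' 2 k]
  refine ⟨p + 1, p.succ_pos, 2 ^ (p + 1), by positivity, fun t X ht hX ↦ ?_⟩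
  have hFX := hpos X
  have h1 : (1 : ℝ) ≤ 2 ^ (p + 1) := one_le_pow₀ one_le_two
  rcases le_total X t with hXt | hXt
  · refine (hF hXt).trans (le_mul_of_one_le_left hFX.le ?_)
    have : 0 ≤ (X / t) ^ (p + 1) := by positivity
    nlinarith
  · obtain ⟨k, hk1, hk2⟩ := exists_nat_pow_near ((one_le_div ht).2 hXt) one_lt_two
    have h2 : X / 2 ^ (k + 1) ≤ t := by
      rw [div_lt_iff₀ ht] at hk2
      rw [div_le_iff₀ (by positivity)]
      linarith
    calc F t ≤ F (X / 2 ^ (k + 1)) := hF h2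
      _ ≤ (2 ^ (k + 1)) ^ (p + 1) * F X := hiter _ _
      _ = 2 ^ (p + 1) * (2 ^ k) ^ (p + 1) * F X := by rw [← mul_pow, pow_succ' 2 k]
      _ ≤ _ := by
        gcongr
        calc ((2 : ℝ) ^ k) ^ (p + 1) ≤ (X / t) ^ (p + 1) := by gcongr
          _ ≤ _ := by linarith

end RegularVariation

/-! ### Matching levels `v` with time scales `b` -/

section Rpow

variable {α v t : ℝ}

/-- The base `v ^ (-(2 * α))⁻¹` is the `b` with `b ^ (-(2α)) = v`, so that `P(ς > b√x) / P(ς > √x)`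
tends to `v`. -/
lemma rpow_inv_neg_two_mul_sq (hα : 0 < α) (hv : 0 < v) :
    (v ^ (-(2 * α))⁻¹) ^ 2 = (v ^ α⁻¹)⁻¹ := by
  rw [← Real.rpow_natCast, ← Real.rpow_mul hv.le, ← Real.rpow_neg hv.le]
  congr 1
  push_cast
  field_simp

lemma one_lt_rpow_sq_mul_iff (hα : 0 < α) (hv : 0 < v) (ht : 0 < t) :
    1 < (v ^ (-(2 * α))⁻¹) ^ 2 * t ↔ v < t ^ α := by
  rw [rpow_inv_neg_two_mul_sq hα hv, inv_mul_eq_div, one_lt_div (Real.rpow_pos_of_pos hv _),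
    Real.rpow_inv_lt_iff_of_pos hv.le ht.le hα]

lemma one_le_rpow_sq_mul_iff (hα : 0 < α) (hv : 0 < v) (ht : 0 < t) :
    1 ≤ (v ^ (-(2 * α))⁻¹) ^ 2 * t ↔ v ≤ t ^ α := by
  rw [rpow_inv_neg_two_mul_sq hα hv, inv_mul_eq_div, one_le_div (Real.rpow_pos_of_pos hv _),
    Real.rpow_inv_le_iff_of_pos hv.le ht.le hα]

end Rpow

/-! ### The random time: conditioning, domination and passage to the limit -/

section RandomTime

variable {Ω : Type*} {G : ℕ → ℕ → Ω → ℕ}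

lemma W_mono (ω : Ω) : Monotone fun n ↦ W G n ω :=
  monotone_nat_of_le_succ fun n ↦ by rw [W_succ]; exact Nat.le_add_right _ _

variable [mΩ : MeasurableSpace Ω] {μ : Measure Ω} {ς : Ω → ℕ}

/-- The tail `P(ς > x)`. -/
noncomputable def tail (μ : Measure Ω) (ς : Ω → ℕ) (x : ℝ) : ℝ := μ.real {ω | x < (ς ω : ℝ)}

/-- The conditional probability that `W G ς` exceeds `x`, given the path of `W`. -/
noncomputable def condTail (μ : Measure Ω) (G : ℕ → ℕ → Ω → ℕ) (ς : Ω → ℕ) (x : ℝ) (ω : Ω) : ℝ :=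
  (μ.map ς).real {n | x < (W G n ω : ℝ)}

lemma condTail_nonneg (x : ℝ) (ω : Ω) : 0 ≤ condTail μ G ς x ω := measureReal_nonneg

lemma map_Ioi_eq_tail (hς : Measurable ς) (y : ℝ) :
    (μ.map ς).real {n : ℕ | y < (n : ℝ)} = tail μ ς y :=
  map_measureReal_apply hς (MeasurableSet.of_discrete)

lemma measurable_path (hG : IsOffspringArray μ G) : Measurable fun ω (n : ℕ) ↦ W G n ω :=
  measurable_pi_lambda _ fun n ↦ measurable_W hG n

/-- The probability that the conditional tail at `x`, normalized by `P(ς > √x)`, exceeds `v`. -/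
noncomputable def level (μ : Measure Ω) (G : ℕ → ℕ → Ω → ℕ) (ς : Ω → ℕ) (x v : ℝ) : ℝ≥0∞ :=
  μ {ω | v < condTail μ G ς x ω / tail μ ς √x}

lemma level_antitone (x : ℝ) : Antitone (level μ G ς x) := fun _ _ h ↦
  measure_mono fun _ hω ↦ lt_of_le_of_lt h hω

variable [IsProbabilityMeasure μ]

lemma tail_antitone : Antitone (tail μ ς) := fun _ _ h ↦
  measureReal_mono fun _ hω ↦ lt_of_le_of_lt h hω

lemma tail_le_one (x : ℝ) : tail μ ς x ≤ 1 := measureReal_le_one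

/-- Once `W` has passed `x` by time `⌊y⌋`, monotonicity keeps it above `x` at every `n > y`. -/
lemma tail_le_condTail (hς : Measurable ς) {x y : ℝ} (hy : 0 ≤ y) {ω : Ω}
    (h : x < (W G ⌊y⌋₊ ω : ℝ)) : tail μ ς y ≤ condTail μ G ς x ω := by
  have := Measure.isProbabilityMeasure_map (μ := μ) hς.aemeasurable
  rw [← map_Ioi_eq_tail hς]
  refine measureReal_mono fun n (hn : y < n) ↦ ?_
  have : ⌊y⌋₊ ≤ n := (Nat.floor_lt hy).2 hn |>.le
  exact h.trans_le (by exact_mod_cast W_mono ω this)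

lemma condTail_le_tail (hς : Measurable ς) {x y : ℝ} {ω : Ω}
    (h : (W G ⌊y⌋₊ ω : ℝ) ≤ x) : condTail μ G ς x ω ≤ tail μ ς y := by
  have := Measure.isProbabilityMeasure_map (μ := μ) hς.aemeasurable
  rw [← map_Ioi_eq_tail hς]
  refine measureReal_mono fun n (hn : x < (W G n ω : ℝ)) ↦ ?_
  refine Nat.lt_of_floor_lt (a := y) (lt_of_not_ge fun hle ↦ ?_)
  have : W G n ω ≤ W G ⌊y⌋₊ ω := W_mono ω hle
  have : (W G n ω : ℝ) ≤ W G ⌊y⌋₊ ω := by exact_mod_cast this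
  linarith

lemma measurableSet_lt_eval (x : ℝ) :
    MeasurableSet {q : (ℕ → ℕ) × ℕ | x < (q.1 q.2 : ℝ)} := by
  have : Measurable fun q : (ℕ → ℕ) × ℕ ↦ (q.1 q.2 : ℝ) :=
    measurable_from_prod_countable_left fun n ↦ by fun_prop
  exact measurableSet_lt measurable_const this

lemma measurable_condTail (hG : IsOffspringArray μ G) (hς : Measurable ς) (x : ℝ) :
    Measurable (condTail μ G ς x) := by
  have := Measure.isProbabilityMeasure_map (μ := μ) hς.aemeasurable
  have h := (measurable_measure_prodMk_left (ν := μ.map ς) (measurableSet_lt_eval x)).comp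
    (measurable_path hG)
  exact h.ennreal_toReal

lemma measure_lt_W_eq_lintegral (hG : IsOffspringArray μ G) (hς : Measurable ς)
    (hindep : IndepFun (fun ω (n : ℕ) ↦ W G n ω) ς μ) (x : ℝ) :
    μ {ω | x < (W G (ς ω) ω : ℝ)} = ∫⁻ ω, ENNReal.ofReal (condTail μ G ς x ω) ∂μ := by
  have := Measure.isProbabilityMeasure_map (μ := μ) hς.aemeasurable
  have hp := measurable_path hG
  have h1 := (indepFun_iff_map_prod_eq_prod_map_map hp.aemeasurable hς.aemeasurable).1 hindep
  have h2 := Measure.map_apply (μ := μ) (hp.prodMk hς) (measurableSet_lt_eval x)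
  rw [h1, Measure.prod_apply (measurableSet_lt_eval x), lintegral_map
    (measurable_measure_prodMk_left (measurableSet_lt_eval x)) hp] at h2
  refine Eq.trans h2.symm (lintegral_congr fun ω ↦ ?_)
  exact (ofReal_measureReal (μ := μ.map ς)).symm

/-- Layer-cake formula for the normalised conditional tail. -/
lemma ofReal_tail_ratio_eq_lintegral_level (hG : IsOffspringArray μ G) (hς : Measurable ς)
    (hindep : IndepFun (fun ω (n : ℕ) ↦ W G n ω) ς μ) {x : ℝ} (hx : 0 < tail μ ς √x) :
    ENNReal.ofReal (μ.real {ω | x < (W G (ς ω) ω : ℝ)} / tail μ ς √x) =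
      ∫⁻ v in Set.Ioi 0, level μ G ς x v := by
  have hm := measurable_condTail hG hς x
  unfold level
  rw [← lintegral_eq_lintegral_meas_lt μ
    (ae_of_all _ fun ω ↦ div_nonneg (condTail_nonneg x ω) hx.le) (hm.div_const _).aemeasurable,
    ENNReal.ofReal_div_of_pos hx, ofReal_measureReal, measure_lt_W_eq_lintegral hG hς hindep,
    div_eq_mul_inv, ← lintegral_mul_const _ hm.ennreal_ofReal]
  refine lintegral_congr fun ω ↦ ?_
  rw [ENNReal.ofReal_div_of_pos hx, div_eq_mul_inv]

lemma level_le_measure_W (hς : Measurable ς) {x b v : ℝ} (hx : 0 < tail μ ς √x)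
    (h : tail μ ς (b * √x) ≤ v * tail μ ς √x) :
    level μ G ς x v ≤ μ {ω | x < (W G ⌊b * √x⌋₊ ω : ℝ)} := by
  refine measure_mono fun ω (hω : v < _) ↦ ?_
  refine lt_of_not_ge (α := ℝ) fun hle ↦ ?_
  rw [lt_div_iff₀ hx] at hω
  have := condTail_le_tail (μ := μ) hς hle
  linarith

lemma measure_W_le_level (hς : Measurable ς) {x b v : ℝ} (hb : 0 ≤ b) (hx : 0 < tail μ ς √x)
    (h : v * tail μ ς √x < tail μ ς (b * √x)) :
    μ {ω | x < (W G ⌊b * √x⌋₊ ω : ℝ)} ≤ level μ G ς x v := by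
  refine measure_mono fun ω (hω : x < _) ↦ ?_
  refine (lt_div_iff₀ hx).2 (h.trans_le ?_)
  exact tail_le_condTail hς (by positivity) hω

/-- An integrable bound for `level`, uniform in `x`. -/
lemma exists_level_bound (hG : IsOffspringArray μ G) (hς : Measurable ς) {ℓ : ℝ → ℝ} {β : ℝ}
    (hℓ : SlowlyVarying ℓ) (htail : tail μ ς ~[atTop] fun x ↦ x ^ β * ℓ x) :
    ∃ B : ℝ → ℝ≥0∞, (∀ x v, 0 < x → 0 < v → level μ G ς x v ≤ B v) ∧
      ∫⁻ v in Set.Ioi 0, B v ≠ ⊤ := by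
  obtain ⟨p, hp, C, hC, hpot⟩ := exists_potter_bound tail_antitone tail_le_one hℓ htail
  have hpos := pos_of_isEquivalent_rpow_mul tail_antitone hℓ htail
  obtain ⟨D, hD, hW⟩ := exists_measure_lt_W_le hG p
  -- Up to `2C` the trivial bound `1` is used; beyond it the tail bound of order `p`, the Potter
  -- exponent, gives an integrable `v^(-2)`.
  refine ⟨fun v ↦ (Set.Iic (2 * C)).indicator 1 v +
    (Set.Ioi (2 * C)).indicator (fun v ↦ ENNReal.ofReal (D * (2 * C) ^ 2 * v ^ (-2 : ℝ))) v,
    fun x v hx hv ↦ ?_, ?_⟩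
  · rcases le_or_gt v (2 * C) with h | h
    · refine le_add_right ?_
      rw [Set.indicator_of_mem (Set.mem_Iic.2 h)]
      exact prob_le_one
    · refine le_add_left ?_
      rw [Set.indicator_of_mem (Set.mem_Ioi.2 h)]
      have hsx : 0 < √x := Real.sqrt_pos.2 hx
      -- With `b^p = 2C/v` the Potter factor `C(1 + b^(-p))` equals `C + v/2`, which is at most `v`
      -- when `v > 2C`.
      set b : ℝ := (2 * C / v) ^ (1 / (p : ℝ)) with hb
      have hb0 : 0 < b := Real.rpow_pos_of_pos (by positivity) _
      have hbp : b ^ p = 2 * C / v := by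
        rw [hb, ← Real.rpow_natCast, ← Real.rpow_mul (by positivity),
          one_div_mul_cancel (by positivity), Real.rpow_one]
      have h1 : tail μ ς (b * √x) ≤ v * tail μ ς √x := by
        refine (hpot (b * √x) √x (by positivity) hsx).trans
          (mul_le_mul_of_nonneg_right ?_ (hpos _).le)
        have : √x / (b * √x) = b⁻¹ := by field_simp
        rw [this, inv_pow, hbp, inv_div]
        have : C * (1 + v / (2 * C)) = C + v / 2 := by field_simp
        rw [this]; linarith
      refine (level_le_measure_W hς (hpos _) h1).trans ((hW _ x hx).trans ?_)
      refine ENNReal.ofReal_le_ofReal ?_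
      rw [mul_assoc]
      refine mul_le_mul_of_nonneg_left ?_ hD.le
      have h2 : (⌊b * √x⌋₊ : ℝ) ≤ b * √x := Nat.floor_le (by positivity)
      calc ((⌊b * √x⌋₊ : ℝ) ^ 2 / x) ^ p ≤ ((b * √x) ^ 2 / x) ^ p := by gcongr
        _ = (b ^ p) ^ 2 := by
          rw [mul_pow, Real.sq_sqrt hx.le, mul_div_assoc, div_self hx.ne', mul_one, pow_right_comm]
        _ = (2 * C) ^ 2 * v ^ (-2 : ℝ) := by
          rw [hbp, div_pow, Real.rpow_neg hv.le, Real.rpow_two, div_eq_mul_inv]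
  · rw [lintegral_add_left (measurable_one.indicator measurableSet_Iic)]
    refine ENNReal.add_ne_top.2 ⟨?_, ?_⟩
    · rw [lintegral_indicator_one measurableSet_Iic, Measure.restrict_apply measurableSet_Iic]
      refine ((measure_mono (t := Set.Icc 0 (2 * C)) ?_).trans_lt measure_Icc_lt_top).ne
      exact fun v hv ↦ ⟨le_of_lt hv.2, hv.1⟩
    · have h3 := (integrableOn_Ioi_rpow_of_lt (a := -2) (by norm_num)
        (by positivity : 0 < 2 * C)).const_mul (D * (2 * C) ^ 2)
      rw [lintegral_indicator measurableSet_Ioi, Measure.restrict_restrict measurableSet_Ioi,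
        Set.Ioi_inter_Ioi, max_eq_left (by positivity)]
      exact h3.lintegral_lt_top.ne

variable {ν : Measure ℝ} {α : ℝ} {ℓ : ℝ → ℝ}

/-- The tail ratio at scale `b` only tends to `v'`; the gap `v < v'` makes it eventually exceed `v`.
-/
lemma le_liminf_level (hG : IsOffspringArray μ G) (hς : Measurable ς) (hα : 0 < α)
    (hℓ : SlowlyVarying ℓ) (htail : tail μ ς ~[atTop] fun x ↦ x ^ (-(2 * α)) * ℓ x)
    (hν : IsVarthetaLaw ν) {v v' : ℝ} (hv : 0 < v) (hvv : v < v') :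
    ν {t | v' < t ^ α} ≤ liminf (fun x ↦ level μ G ς x v) atTop := by
  have hpos := pos_of_isEquivalent_rpow_mul tail_antitone hℓ htail
  have hv' : 0 < v' := hv.trans hvv
  set b : ℝ := v' ^ (-(2 * α))⁻¹ with hb
  have hb0 : 0 < b := Real.rpow_pos_of_pos hv' _
  have hbv : b ^ (-(2 * α)) = v' := Real.rpow_inv_rpow hv'.le (by linarith)
  have hratio := (tendsto_div_of_isEquivalent_rpow_mul hℓ htail hb0).comp Real.tendsto_sqrt_atTop
  rw [hbv] at hratio
  have hset : ν {t | v' < t ^ α} = ν {t | 1 < b ^ 2 * t} := by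
    refine measure_congr ?_
    filter_upwards [hν.ae_pos] with t ht
    exact propext (one_lt_rpow_sq_mul_iff hα hv' ht).symm
  rw [hset]
  refine (le_liminf_measure_lt_W hG hν hb0.le (tendsto_floor_mul_sqrt_div hb0.le)).trans
    (liminf_le_liminf ?_)
  filter_upwards [hratio.eventually (lt_mem_nhds hvv)] with x hx
  exact measure_W_le_level hς hb0.le (hpos _) ((lt_div_iff₀ (hpos _)).1 hx)

lemma limsup_level_le (hG : IsOffspringArray μ G) (hς : Measurable ς) (hα : 0 < α)
    (hℓ : SlowlyVarying ℓ) (htail : tail μ ς ~[atTop] fun x ↦ x ^ (-(2 * α)) * ℓ x)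
    (hν : IsVarthetaLaw ν) {v v' : ℝ} (hv' : 0 < v') (hvv : v' < v) :
    limsup (fun x ↦ level μ G ς x v) atTop ≤ ν {t | v' ≤ t ^ α} := by
  have hpos := pos_of_isEquivalent_rpow_mul tail_antitone hℓ htail
  set b : ℝ := v' ^ (-(2 * α))⁻¹ with hb
  have hb0 : 0 < b := Real.rpow_pos_of_pos hv' _
  have hbv : b ^ (-(2 * α)) = v' := Real.rpow_inv_rpow hv'.le (by linarith)
  have hratio := (tendsto_div_of_isEquivalent_rpow_mul hℓ htail hb0).comp Real.tendsto_sqrt_atTop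
  rw [hbv] at hratio
  have hset : ν {t | v' ≤ t ^ α} = ν {t | 1 ≤ b ^ 2 * t} := by
    refine measure_congr ?_
    filter_upwards [hν.ae_pos] with t ht
    exact propext (one_le_rpow_sq_mul_iff hα hv' ht).symm
  rw [hset]
  refine (limsup_le_limsup ?_).trans
    (limsup_measure_le_W hG hν hb0.le (tendsto_floor_mul_sqrt_div hb0.le))
  filter_upwards [hratio.eventually (gt_mem_nhds hvv)] with x hx
  exact level_le_measure_W hς (hpos _) ((div_lt_iff₀ (hpos _)).1 hx).le

lemma ae_tendsto_level (hG : IsOffspringArray μ G) (hς : Measurable ς) (hα : 0 < α)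
    (hℓ : SlowlyVarying ℓ) (htail : tail μ ς ~[atTop] fun x ↦ x ^ (-(2 * α)) * ℓ x)
    (hν : IsVarthetaLaw ν) : ∀ᵐ v ∂(volume.restrict (Set.Ioi (0 : ℝ))),
      Tendsto (fun x ↦ level μ G ς x v) atTop (𝓝 (ν {t | v < t ^ α})) := by
  have hanti : Antitone fun v : ℝ ↦ ν {t | v < t ^ α} := fun _ _ h ↦
    measure_mono fun _ ht ↦ lt_of_le_of_lt h ht
  -- A monotone function has countably many discontinuities; at continuity points the gaps between
  -- `v` and `v'` can be closed.
  have hcount : ∀ᵐ v ∂(volume.restrict (Set.Ioi (0 : ℝ))),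
      ContinuousAt (fun v : ℝ ↦ ν {t | v < t ^ α}) v :=
    hanti.countable_not_continuousAt.measure_zero _
  filter_upwards [hcount, ae_restrict_mem measurableSet_Ioi] with v hc (hv : 0 < v)
  refine tendsto_of_le_liminf_of_limsup_le ?_ ?_
  · refine le_of_tendsto (hc.tendsto.mono_left (nhdsWithin_le_nhds (s := Set.Ioi v))) ?_
    filter_upwards [self_mem_nhdsWithin] with v' hv'
    exact le_liminf_level hG hς hα hℓ htail hν hv hv'
  · refine ge_of_tendsto (hc.tendsto.mono_left (nhdsWithin_le_nhds (s := Set.Iio v))) ?_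
    filter_upwards [Ioo_mem_nhdsLT hv] with v' hv'
    -- The midpoint turns the non-strict inequality of the upper bound into a strict one at `v'`.
    refine (limsup_level_le hG hς hα hℓ htail hν (v' := (v' + v) / 2)
      (by linarith [hv'.1]) (by linarith [hv'.2])).trans (measure_mono fun t ht ↦ ?_)
    exact lt_of_lt_of_le (by linarith [hv'.2] : v' < (v' + v) / 2) ht

theorem integrable_and_tendsto_tail_ratio (hG : IsOffspringArray μ G) (hς : Measurable ς)
    (hindep : IndepFun (fun ω (n : ℕ) ↦ W G n ω) ς μ) (hα : 0 < α)
    (hℓ : SlowlyVarying ℓ) (htail : tail μ ς ~[atTop] fun x ↦ x ^ (-(2 * α)) * ℓ x)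
    (hν : IsVarthetaLaw ν) : Integrable (fun t : ℝ ↦ t ^ α) ν ∧
      Tendsto (fun x ↦ μ.real {ω | x < (W G (ς ω) ω : ℝ)} / tail μ ς √x) atTop
        (𝓝 (∫ t, t ^ α ∂ν)) := by
  obtain ⟨B, hB, hBtop⟩ := exists_level_bound hG hς hℓ htail
  have hpos := pos_of_isEquivalent_rpow_mul tail_antitone hℓ htail
  have hBev : ∀ᶠ x in atTop, ∀ᵐ v ∂(volume.restrict (Set.Ioi (0 : ℝ))),
      level μ G ς x v ≤ B v := by
    filter_upwards [eventually_gt_atTop 0] with x hx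
    filter_upwards [ae_restrict_mem measurableSet_Ioi] with v hv using hB x v hx hv
  have hlim := tendsto_lintegral_filter_of_dominated_convergence B
    (Eventually.of_forall fun x ↦ (level_antitone (μ := μ) (G := G) (ς := ς) x).measurable)
    hBev hBtop (ae_tendsto_level hG hς hα hℓ htail hν)
  have hnn : ∀ᵐ t ∂ν, 0 ≤ t ^ α := hν.ae_pos.mono fun t ht ↦ Real.rpow_nonneg ht.le _
  have hm : Measurable fun t : ℝ ↦ t ^ α := by fun_prop
  have hlc := lintegral_eq_lintegral_meas_lt ν hnn hm.aemeasurable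
  rw [← hlc] at hlim
  -- Finiteness of `E ϑ^α` comes from the same dominating function, since the approximating
  -- integrals stay below its integral.
  have hfin : ∫⁻ t, ENNReal.ofReal (t ^ α) ∂ν ≠ ⊤ := by
    refine ne_top_of_le_ne_top hBtop (le_of_tendsto hlim ?_)
    filter_upwards [hBev] with x hx using lintegral_mono_ae hx
  have hint : Integrable (fun t : ℝ ↦ t ^ α) ν :=
    (lintegral_ofReal_ne_top_iff_integrable hm.aestronglyMeasurable hnn).1 hfin
  refine ⟨hint, ?_⟩
  rw [← ofReal_integral_eq_lintegral_ofReal hint hnn] at hlim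
  have h := (ENNReal.tendsto_toReal ENNReal.ofReal_ne_top).comp hlim
  rw [ENNReal.toReal_ofReal (integral_nonneg_of_ae hnn)] at h
  refine h.congr fun x ↦ ?_
  simp only [Function.comp]
  rw [← ofReal_tail_ratio_eq_lintegral_level hG hς hindep (hpos _),
    ENNReal.toReal_ofReal (div_nonneg measureReal_nonneg (hpos _).le)]

lemma IsVarthetaLaw.integral_rpow_pos (hν : IsVarthetaLaw ν)
    (hint : Integrable (fun t : ℝ ↦ t ^ α) ν) : 0 < ∫ t, t ^ α ∂ν := by
  have := hν.isProbabilityMeasure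
  have hpos : ∀ᵐ t ∂ν, 0 < t ^ α := hν.ae_pos.mono fun t ht ↦ Real.rpow_pos_of_pos ht _
  have hnn : 0 ≤ᵐ[ν] fun t ↦ t ^ α := hpos.mono fun t ht ↦ ht.le
  refine lt_of_le_of_ne (integral_nonneg_of_ae hnn) fun h ↦ ?_
  have h0 := (integral_eq_zero_iff_of_nonneg_ae hnn hint).1 h.symm
  obtain ⟨t, h1, h2⟩ := (hpos.and h0).exists
  exact h1.ne' h2

end RandomTime

end CritGW

open CritGW in
theorem proposition5p1 {Ω : Type*} [MeasurableSpace Ω] (μ : Measure Ω) [IsProbabilityMeasure μ]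
    (G : ℕ → ℕ → Ω → ℕ) (hG : CritGW.IsOffspringArray μ G)
    (ς : Ω → ℕ) (hς : Measurable ς)
    (hindep : IndepFun (fun ω (n : ℕ) ↦ CritGW.W G n ω) ς μ)
    (α : ℝ) (hα : 0 < α) (ℓ : ℝ → ℝ) (hℓ : CritGW.SlowlyVarying ℓ)
    (htail : (fun x : ℝ ↦ μ.real {ω | x < (ς ω : ℝ)}) ~[atTop]
      fun x : ℝ ↦ x ^ (-(2 * α)) * ℓ x) :
    (∃ ν : Measure ℝ, CritGW.IsVarthetaLaw ν) ∧
    ∀ ν : Measure ℝ, CritGW.IsVarthetaLaw ν →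
      Integrable (fun t : ℝ ↦ t ^ α) ν ∧
      ((fun x : ℝ ↦ μ.real {ω | x < (CritGW.W G (ς ω) ω : ℝ)}) ~[atTop]
        fun x : ℝ ↦ (∫ t, t ^ α ∂ν) * μ.real {ω | √x < (ς ω : ℝ)}) ∧
      ((fun x : ℝ ↦ (∫ t, t ^ α ∂ν) * μ.real {ω | √x < (ς ω : ℝ)}) ~[atTop]
        fun x : ℝ ↦ (∫ t, t ^ α ∂ν) * (x ^ (-α) * ℓ (√x))) := by
  refine ⟨exists_isVarthetaLaw hG, fun ν hν ↦ ?_⟩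
  have hpos := pos_of_isEquivalent_rpow_mul tail_antitone hℓ htail
  obtain ⟨hint, hlim⟩ := integrable_and_tendsto_tail_ratio hG hς hindep hα hℓ htail hν
  have hc := hν.integral_rpow_pos hint
  refine ⟨hint, ?_, ?_⟩
  · refine (isEquivalent_iff_tendsto_one (Eventually.of_forall fun x ↦
      (mul_pos hc (hpos √x)).ne')).2 ?_
    have h := hlim.div_const (∫ t, t ^ α ∂ν)
    rw [div_self hc.ne'] at h
    refine h.congr fun x ↦ ?_
    simp only [Pi.div_apply, tail]
    rw [div_div, mul_comm]
  · refine IsEquivalent.mul IsEquivalent.refl ?_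
    have h := htail.comp_tendsto Real.tendsto_sqrt_atTop
    refine h.congr_right ?_
    filter_upwards [eventually_ge_atTop 0] with x hx
    simp only [Function.comp]
    rw [Real.sqrt_eq_rpow, ← Real.rpow_mul hx]
    ring_nf
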